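/- Let $G=(V,E)$ be a finite, connected, simple graph with $n=|V|\ge 2$. Random walk on $G$ is a Markov chain $(X_t)_{t\ge 0}$ on $V$ with transition probabilities $p(v,w)=\mathbf 1_{\{v\sim w\}}/d_v$, where $d_v$ is the degree of $v$, and with an arbitrary distribution of $X_0$. Let $1=\lambda_1\ge\lambda_2\ge\cdots\ge\lambda_n\ge -1$ be the eigenvalues, with multiplicity, of its transition matrix. $G$ is called an $\varepsilon$-expander if $\max\{|\lambda_2|,|\lambda_n|\}<1-\varepsilon$. Theorem. For every $\varepsilon>0$ and every real $C$ there is a constant $c=c(\varepsilon,C)>0$ such that for every $\varepsilon$-expander $G$ with vertex set $V$ of size $n\ge 2$ and every random walk $(X_t)$ on $G$, $$\Pr\bigl(\{X_t : 1\le t\le Cn,\ t\in\mathbb{Z}\}=V\bigr)\le e^{-cn}.$$ -/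

import Mathlib

open MeasureTheory

noncomputable section

/-- Transition matrix of random walk on `G`: `p(v,w) = 1_{v ~ w} / d_v`. -/
def walkMatrix {V : Type*} [Fintype V] (G : SimpleGraph V) [DecidableRel G.Adj] :
    Matrix V V ℝ :=
  Matrix.of fun v w => if G.Adj v w then 1 / (G.degree v : ℝ) else 0

/-- The eigenvalues `l₁ ≥ l₂ ≥ ⋯ ≥ lₙ` of the transition matrix, listed in decreasing order with
algebraic multiplicity (the matrix is similar to a real symmetric one, so all are real). -/
def walkEigenvalues {V : Type*} [Fintype V] [DecidableEq V] (G : SimpleGraph V)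
    [DecidableRel G.Adj] : List ℝ :=
  (walkMatrix G).charpoly.roots.sort (· ≥ ·)

/-- `G` is an `ε`-expander: `max {|l₂|, |lₙ|} < 1 - ε`. List positions start at `0`, so `l₂` is at
position `1` and `lₙ` at position `n - 1`. Meant for graphs with at least two vertices. -/
def IsExpander {V : Type*} [Fintype V] [DecidableEq V] (G : SimpleGraph V)
    [DecidableRel G.Adj] (ε : ℝ) : Prop :=
  max |(walkEigenvalues G).getD 1 0| |(walkEigenvalues G).getD (Fintype.card V - 1) 0| < 1 - ε

/-- `(X_t)_{t ≥ 0}` is a random walk on `G`: a Markov chain with transition matrix `walkMatrix G`,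
with an arbitrary law of `X_0`. -/
structure IsRandomWalk {V : Type*} [Fintype V] (G : SimpleGraph V) [DecidableRel G.Adj]
    {Ω : Type*} [MeasurableSpace Ω] (μ : Measure Ω) (X : ℕ → Ω → V) : Prop where
  measurableSet_eq : ∀ (t : ℕ) (v : V), MeasurableSet {ω | X t ω = v}
  path_prob : ∀ (m : ℕ) (v : ℕ → V),
    μ.real {ω | ∀ i ≤ m, X i ω = v i} =
      μ.real {ω | X 0 ω = v 0} * ∏ i ∈ Finset.range m, walkMatrix G (v i) (v (i + 1))

/-- The set `X_{[m]} = {X_1, …, X_m}` of states visited at times `1, …, m`. -/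
def visited {V Ω : Type*} (X : ℕ → Ω → V) (m : ℕ) (ω : Ω) : Set V :=
  (fun t => X t ω) '' Set.Icc 1 m

end

/-! Cut the time interval into boundedly many blocks of about `n / 160` steps. The stationary law
`π` is proportional to the degree, so some set `S` of at least half of the vertices has `π v ≤ 2 /
n` on it. If `W ⊆ S` is the part of `S` not yet visited when a block starts, the stationary mean
number of visits to `W` in the block is at most `|W| / 80`. Outside an event of exponentially small
probability the block therefore leaves at least a third of `W` unvisited, and after all blocks a
linear number of vertices remains.

The concentration comes from the spectral gap: multiplying by `1 + τ` on `W` and then applying the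
walk matrix raises the squared `L²(π)` norm by at most the factor `1 + 10 τ π(W)`
(`sum_sq_mulVec_visit_le`). Iteration bounds the exponential moment of the visit count from every
starting point (`visitMgf_le_mul_exp`). `coverProb_add_le` turns this into a one-block estimate, and
`coverProb_blocks_le` iterates it.

The resulting bound carries a polynomial prefactor, so it is useful only for large `n`. For small
`n` the walk may bounce along one edge, which misses a third vertex with probability bounded below
(`IsExpander.coverProb_le_one_sub`). -/

/-! ### Spectral gap in quadratic form -/

section Spectral

variable {V : Type*} [Fintype V]

section Hermitian

variable [DecidableEq V]

theorem Matrix.IsHermitian.sum_dotProduct_eigenvectorBasis {A : Matrix V V ℝ}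
    (hA : A.IsHermitian) (x y : V → ℝ) :
    ∑ i, ((hA.eigenvectorBasis i).ofLp ⬝ᵥ x) * ((hA.eigenvectorBasis i).ofLp ⬝ᵥ y) = x ⬝ᵥ y := by
  have h := hA.eigenvectorBasis.sum_inner_mul_inner (WithLp.toLp 2 x) (WithLp.toLp 2 y)
  simp only [EuclideanSpace.inner_eq_star_dotProduct, star_trivial] at h
  rw [dotProduct_comm x y, ← h]
  refine Finset.sum_congr rfl fun i _ => ?_
  rw [dotProduct_comm y]

theorem Matrix.IsHermitian.eigenvectorBasis_dotProduct_mulVec {A : Matrix V V ℝ}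
    (hA : A.IsHermitian) (i : V) (x : V → ℝ) :
    (hA.eigenvectorBasis i).ofLp ⬝ᵥ A.mulVec x =
      hA.eigenvalues i * ((hA.eigenvectorBasis i).ofLp ⬝ᵥ x) := by
  have hT : A.transpose = A := by
    rw [← Matrix.conjTranspose_eq_transpose_of_trivial]; exact hA.eq
  rw [Matrix.dotProduct_mulVec, ← Matrix.mulVec_transpose, hT, hA.mulVec_eigenvectorBasis,
    smul_dotProduct, smul_eq_mul]

/-- If `w` is fixed by a symmetric matrix whose other eigenvalues are at most `r < 1` in absolute
value, then the matrix contracts the orthogonal complement of `w` by the factor `r`. -/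
theorem Matrix.IsHermitian.mulVec_sq_le {A : Matrix V V ℝ} (hA : A.IsHermitian) {w : V → ℝ}
    (hw : A.mulVec w = w) (hw0 : 0 < w ⬝ᵥ w) {r : ℝ} (hr : r < 1) (i₀ : V)
    (h : ∀ i, i ≠ i₀ → |hA.eigenvalues i| ≤ r) (x : V → ℝ) :
    A.mulVec x ⬝ᵥ A.mulVec x ≤ r ^ 2 * (x ⬝ᵥ x) + (1 - r ^ 2) * (w ⬝ᵥ x) ^ 2 / (w ⬝ᵥ w) := by
  set e : V → V → ℝ := fun i => (hA.eigenvectorBasis i).ofLp with he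
  -- Eigenvectors for eigenvalues other than `1` are orthogonal to `w`. Hence `w` is a multiple of
  -- `e i₀`, and the eigenvalue at `i₀` must be `1`.
  have hzero : ∀ i, i ≠ i₀ → e i ⬝ᵥ w = 0 := by
    intro i hi
    have h1 := hA.eigenvectorBasis_dotProduct_mulVec i w
    rw [hw] at h1
    have h2 : hA.eigenvalues i < 1 := lt_of_le_of_lt ((le_abs_self _).trans (h i hi)) hr
    have h3 : (1 - hA.eigenvalues i) * (e i ⬝ᵥ w) = 0 := by
      linarith
    exact (mul_eq_zero.mp h3).resolve_left (by linarith)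
  have hww : (e i₀ ⬝ᵥ w) * (e i₀ ⬝ᵥ w) = w ⬝ᵥ w := by
    rw [← hA.sum_dotProduct_eigenvectorBasis w w]
    symm
    refine Finset.sum_eq_single i₀ (fun i _ hi => ?_) (fun h => absurd (Finset.mem_univ _) h)
    have := hzero i hi
    simp only [he] at this
    rw [this, zero_mul]
  have hwx : (e i₀ ⬝ᵥ w) * (e i₀ ⬝ᵥ x) = w ⬝ᵥ x := by
    rw [← hA.sum_dotProduct_eigenvectorBasis w x]
    symm
    refine Finset.sum_eq_single i₀ (fun i _ hi => ?_) (fun h => absurd (Finset.mem_univ _) h)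
    have := hzero i hi
    simp only [he] at this
    rw [this, zero_mul]
  have hne : e i₀ ⬝ᵥ w ≠ 0 := by
    intro h0
    rw [h0] at hww
    linarith
  have heig : hA.eigenvalues i₀ = 1 := by
    have h1 := hA.eigenvectorBasis_dotProduct_mulVec i₀ w
    rw [hw] at h1
    have h3 : (1 - hA.eigenvalues i₀) * (e i₀ ⬝ᵥ w) = 0 := by
      linarith
    linarith [(mul_eq_zero.mp h3).resolve_right hne]
  have hfrac : (w ⬝ᵥ x) ^ 2 / (w ⬝ᵥ w) = (e i₀ ⬝ᵥ x) ^ 2 := by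
    rw [← hwx, ← hww]
    field_simp
  rw [mul_div_assoc, hfrac, ← hA.sum_dotProduct_eigenvectorBasis (A.mulVec x),
    ← hA.sum_dotProduct_eigenvectorBasis x x]
  simp only [hA.eigenvectorBasis_dotProduct_mulVec]
  change ∑ i, hA.eigenvalues i * (e i ⬝ᵥ x) * (hA.eigenvalues i * (e i ⬝ᵥ x)) ≤
    r ^ 2 * ∑ i, (e i ⬝ᵥ x) * (e i ⬝ᵥ x) + _
  rw [← Finset.add_sum_erase _ _ (Finset.mem_univ i₀),
    ← Finset.add_sum_erase _ (fun i => (e i ⬝ᵥ x) * (e i ⬝ᵥ x)) (Finset.mem_univ i₀), heig]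
  have hrest : ∑ i ∈ Finset.univ.erase i₀,
        hA.eigenvalues i * (e i ⬝ᵥ x) * (hA.eigenvalues i * (e i ⬝ᵥ x)) ≤
      r ^ 2 * ∑ i ∈ Finset.univ.erase i₀, (e i ⬝ᵥ x) * (e i ⬝ᵥ x) := by
    rw [Finset.mul_sum]
    refine Finset.sum_le_sum fun i hi => ?_
    have h1 : hA.eigenvalues i ^ 2 ≤ r ^ 2 := by
      rw [← sq_abs (hA.eigenvalues i)]
      gcongr
      exact h i (Finset.ne_of_mem_erase hi)
    nlinarith [mul_self_nonneg (e i ⬝ᵥ x)]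
  linarith

end Hermitian

variable (G : SimpleGraph V) [DecidableRel G.Adj]

/-- The symmetric matrix `1_{v ~ w} / √(d_v d_w)`, which is similar to `walkMatrix G`. -/
noncomputable def normalizedAdj : Matrix V V ℝ :=
  Matrix.of fun v w => if G.Adj v w then (√(G.degree v : ℝ))⁻¹ * (√(G.degree w : ℝ))⁻¹ else 0

theorem isHermitian_normalizedAdj : (normalizedAdj G).IsHermitian := by
  ext v w
  simp only [normalizedAdj, Matrix.conjTranspose_apply, Matrix.of_apply, star_trivial,
    G.adj_comm w v, mul_comm]

theorem normalizedAdj_mulVec (hd : ∀ v, 0 < G.degree v) (f : V → ℝ) (v : V) :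
    (normalizedAdj G).mulVec (fun w => √(G.degree w : ℝ) * f w) v =
      √(G.degree v : ℝ) * (walkMatrix G).mulVec f v := by
  simp only [Matrix.mulVec, dotProduct, normalizedAdj, walkMatrix, Matrix.of_apply,
    Finset.mul_sum]
  refine Finset.sum_congr rfl fun w _ => ?_
  split_ifs
  · have hv : √(G.degree v : ℝ) ≠ 0 := (Real.sqrt_pos.mpr (by exact_mod_cast hd v)).ne'
    have hw : √(G.degree w : ℝ) ≠ 0 := (Real.sqrt_pos.mpr (by exact_mod_cast hd w)).ne'
    have hvv : (G.degree v : ℝ) = √(G.degree v : ℝ) * √(G.degree v : ℝ) :=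
      (Real.mul_self_sqrt (Nat.cast_nonneg _)).symm
    nth_rewrite 3 [hvv]
    field_simp
  · simp

theorem walkMatrix_sum_row (hd : ∀ v, 0 < G.degree v) (v : V) :
    ∑ w, walkMatrix G v w = 1 := by
  have hv : (G.degree v : ℝ) ≠ 0 := by exact_mod_cast (hd v).ne'
  simp only [walkMatrix, Matrix.of_apply]
  rw [← Finset.sum_filter, Finset.sum_const, ← SimpleGraph.neighborFinset_eq_filter,
    SimpleGraph.card_neighborFinset_eq_degree, nsmul_eq_mul, mul_one_div_cancel hv]

theorem walkMatrix_nonneg (v w : V) : 0 ≤ walkMatrix G v w := by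
  simp only [walkMatrix, Matrix.of_apply]
  split_ifs <;> positivity

variable [DecidableEq V]

/-- The two matrices are `(S * A) * S` and `S * (S * A)`, and the characteristic polynomial is
invariant under swapping factors. `S` need not be invertible, so isolated vertices do no harm. -/
theorem charpoly_normalizedAdj : (normalizedAdj G).charpoly = (walkMatrix G).charpoly := by
  set S : Matrix V V ℝ := Matrix.diagonal fun v => (√(G.degree v : ℝ))⁻¹
  have h1 : normalizedAdj G = (S * G.adjMatrix ℝ) * S := by
    ext v w
    simp only [S, normalizedAdj, Matrix.of_apply, Matrix.mul_diagonal, Matrix.diagonal_mul,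
      SimpleGraph.adjMatrix_apply]
    split_ifs <;> simp
  have h2 : walkMatrix G = S * (S * G.adjMatrix ℝ) := by
    ext v w
    simp only [S, walkMatrix, Matrix.of_apply, Matrix.diagonal_mul, SimpleGraph.adjMatrix_apply]
    split_ifs
    · rw [mul_one, ← mul_inv, Real.mul_self_sqrt (Nat.cast_nonneg _), one_div]
    · simp
  rw [h1, h2, Matrix.charpoly_mul_comm]

theorem walkEigenvalues_eq :
    walkEigenvalues G = List.ofFn (isHermitian_normalizedAdj G).eigenvalues₀ := by
  rw [← (isHermitian_normalizedAdj G).sort_roots_charpoly_eq_eigenvalues₀, walkEigenvalues,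
    charpoly_normalizedAdj]
  congr 1
  exact (Multiset.map_id _).symm

variable {G}

theorem IsExpander.lt_one {ε : ℝ} (h : IsExpander G ε) : ε < 1 := by
  have h1 := (abs_nonneg _).trans_lt ((le_max_left _ _).trans_lt h)
  linarith

theorem IsExpander.abs_eigenvalues_le {ε : ℝ} (h : IsExpander G ε) (h2 : 2 ≤ Fintype.card V) :
    ∃ i₀, ∀ i, i ≠ i₀ → |(isHermitian_normalizedAdj G).eigenvalues i| ≤ 1 - ε := by
  set hA := isHermitian_normalizedAdj G
  -- This is the bijection in the definition of `eigenvalues`, which makes `hi'` hold by `rfl`.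
  set σ := Fintype.equivOfCardEq (Fintype.card_fin (Fintype.card V)) with hσ
  refine ⟨σ ⟨0, by omega⟩, fun i hi => ?_⟩
  have hi' : hA.eigenvalues i = hA.eigenvalues₀ (σ.symm i) := rfl
  rw [hi']
  have hj : (σ.symm i).val ≠ 0 := by
    intro h0
    apply hi
    rw [← Equiv.symm_apply_eq]
    exact Fin.ext h0
  generalize σ.symm i = j at hj
  unfold IsExpander at h
  rw [walkEigenvalues_eq, List.getD_eq_getElem _ _ (by simp; omega),
    List.getD_eq_getElem _ _ (by simp; omega), List.getElem_ofFn, List.getElem_ofFn] at h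
  have hlo : hA.eigenvalues₀ ⟨Fintype.card V - 1, by omega⟩ ≤ hA.eigenvalues₀ j :=
    hA.eigenvalues₀_antitone (Fin.le_def.mpr (by simp; omega))
  have hhi : hA.eigenvalues₀ j ≤ hA.eigenvalues₀ ⟨1, by omega⟩ :=
    hA.eigenvalues₀_antitone (Fin.le_def.mpr (by simp; omega))
  obtain ⟨ha, hb⟩ := max_lt_iff.mp h
  exact abs_le.mpr ⟨(abs_lt.mp hb).1.le.trans hlo, hhi.trans (abs_lt.mp ha).2.le⟩

/-- Contraction of an expander walk in `L²` of the degree measure. -/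
theorem IsExpander.sum_mulVec_sq_le {ε : ℝ} (h : IsExpander G ε) (hε : 0 < ε)
    (h2 : 2 ≤ Fintype.card V) (hd : ∀ v, 0 < G.degree v) (f : V → ℝ) :
    ∑ v, (G.degree v : ℝ) * (walkMatrix G).mulVec f v ^ 2 ≤
      (1 - ε) ^ 2 * ∑ v, (G.degree v : ℝ) * f v ^ 2 +
        (1 - (1 - ε) ^ 2) * (∑ v, (G.degree v : ℝ) * f v) ^ 2 / ∑ v, (G.degree v : ℝ) := by
  obtain ⟨i₀, hi₀⟩ := h.abs_eigenvalues_le h2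
  -- The image of the constant function under `f ↦ √d * f`, in the shape that `normalizedAdj_mulVec`
  -- rewrites.
  set w : V → ℝ := fun v => √(G.degree v : ℝ) * (fun _ => 1 : V → ℝ) v with hwdef
  have hss : ∀ v, √(G.degree v : ℝ) * √(G.degree v : ℝ) = G.degree v :=
    fun v => Real.mul_self_sqrt (Nat.cast_nonneg _)
  have hw : (normalizedAdj G).mulVec w = w := by
    funext v
    rw [hwdef, normalizedAdj_mulVec G hd]
    simp [Matrix.mulVec, dotProduct, walkMatrix_sum_row G hd]
  have hww : w ⬝ᵥ w = ∑ v, (G.degree v : ℝ) := by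
    simp [dotProduct, hwdef]
  have hpos : 0 < w ⬝ᵥ w := by
    rw [hww]
    exact Finset.sum_pos (fun v _ => by exact_mod_cast hd v) ⟨i₀, Finset.mem_univ _⟩
  have key := (isHermitian_normalizedAdj G).mulVec_sq_le hw hpos (by linarith) i₀ hi₀
    (fun v => √(G.degree v : ℝ) * f v)
  rw [hww] at key
  have e1 : (w ⬝ᵥ fun v => √(G.degree v : ℝ) * f v) = ∑ v, (G.degree v : ℝ) * f v := by
    refine Finset.sum_congr rfl fun v _ => ?_
    simp only [hwdef]
    rw [mul_one, ← mul_assoc, hss]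
  have e2 : ∀ g : V → ℝ, ((fun v => √(G.degree v : ℝ) * g v) ⬝ᵥ
      fun v => √(G.degree v : ℝ) * g v) = ∑ v, (G.degree v : ℝ) * g v ^ 2 := by
    intro g
    refine Finset.sum_congr rfl fun v _ => ?_
    linear_combination (g v) ^ 2 * hss v
  rw [e1, e2, funext (normalizedAdj_mulVec G hd f), e2] at key
  exact key

end Spectral

/-! ### Covering probabilities of a finite Markov chain -/

section Cover

variable {V : Type*} [Fintype V] [DecidableEq V]

/-- Probability that the chain with transition matrix `P`, started at `x`, visits every vertex of
`U` during the steps `1, …, m`. -/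
noncomputable def coverProb (P : Matrix V V ℝ) : ℕ → V → Finset V → ℝ
  | 0, _, U => if U = ∅ then 1 else 0
  | m + 1, x, U => ∑ y, P x y * coverProb P m y (U.erase y)

/-- Expectation of `(1 + τ) ^ N`, where `N` counts the visits to `W` during the steps `1, …, m` of
the chain started at `x`. -/
noncomputable def visitMgf (P : Matrix V V ℝ) (τ : ℝ) (W : Finset V) : ℕ → V → ℝ
  | 0, _ => 1
  | m + 1, x => ∑ y, P x y * ((1 + if y ∈ W then τ else 0) * visitMgf P τ W m y)

theorem visitMgf_nonneg {P : Matrix V V ℝ} (hP : ∀ x y, 0 ≤ P x y) {τ : ℝ} (hτ : 0 ≤ τ)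
    (W : Finset V) (m : ℕ) (x : V) : 0 ≤ visitMgf P τ W m x := by
  induction m generalizing x with
  | zero => simp [visitMgf]
  | succ m ih =>
    refine Finset.sum_nonneg fun y _ => mul_nonneg (hP x y) (mul_nonneg ?_ (ih y))
    split_ifs <;> linarith

variable {P : Matrix V V ℝ}

theorem coverProb_nonneg (hP : ∀ x y, 0 ≤ P x y)
    (m : ℕ) (x : V) (U : Finset V) : 0 ≤ coverProb P m x U := by
  induction m generalizing x U with
  | zero => simp only [coverProb]; split_ifs <;> norm_num
  | succ m ih => exact Finset.sum_nonneg fun y _ => mul_nonneg (hP x y) (ih _ _)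

theorem coverProb_anti (hP : ∀ x y, 0 ≤ P x y)
    {U U' : Finset V} (h : U ⊆ U') (m : ℕ) (x : V) :
    coverProb P m x U' ≤ coverProb P m x U := by
  induction m generalizing x U U' with
  | zero =>
    simp only [coverProb]
    split_ifs with h1 h2
    · rfl
    · exact absurd (Finset.subset_empty.mp (h1 ▸ h)) h2
    · norm_num
    · rfl
  | succ m ih =>
    exact Finset.sum_le_sum fun y _ =>
      mul_le_mul_of_nonneg_left (ih (Finset.erase_subset_erase y h) y) (hP x y)

theorem coverProb_le_one (hP : ∀ x y, 0 ≤ P x y) (hP1 : ∀ x, ∑ y, P x y = 1)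
    (m : ℕ) (x : V) (U : Finset V) : coverProb P m x U ≤ 1 := by
  induction m generalizing x U with
  | zero => simp only [coverProb]; split_ifs <;> norm_num
  | succ m ih =>
    rw [← hP1 x]
    exact Finset.sum_le_sum fun y _ => mul_le_of_le_one_right (hP x y) (ih _ _)

theorem coverProb_mono (hP : ∀ x y, 0 ≤ P x y) (hP1 : ∀ x, ∑ y, P x y = 1)
    {m m' : ℕ} (h : m ≤ m') (x : V) (U : Finset V) :
    coverProb P m x U ≤ coverProb P m' x U := by
  suffices H : ∀ m x U, coverProb P m x U ≤ coverProb P (m + 1) x U from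
    monotone_nat_of_le_succ (f := fun m => coverProb P m x U) (fun m => H m x U) h
  intro m
  induction m with
  | zero =>
    intro x U
    by_cases hU : U = ∅
    · simp [coverProb, hU, hP1]
    · refine le_trans ?_ (coverProb_nonneg hP 1 x U)
      simp [coverProb, hU]
  | succ m ih =>
    intro x U
    exact Finset.sum_le_sum fun y _ => mul_le_mul_of_nonneg_left (ih _ _) (hP x y)

/-- Covering a subset of `W` in `s + m` steps requires either few visits left after `s` steps, or
many visits to `W` during the first `s` steps. -/
theorem coverProb_add_le (hP : ∀ x y, 0 ≤ P x y) (hP1 : ∀ x, ∑ y, P x y = 1)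
    {τ : ℝ} (hτ : 0 ≤ τ) {W : Finset V} {k m : ℕ} {Q : ℝ} (hQ0 : 0 ≤ Q)
    (hQ : ∀ y, ∀ U ⊆ W, k ≤ U.card → coverProb P m y U ≤ Q) (s : ℕ) (x : V) {U : Finset V}
    (hU : U ⊆ W) :
    coverProb P (s + m) x U ≤
      Q + (1 + τ) ^ k / (1 + τ) ^ U.card * visitMgf P τ W s x := by
  have h1 : 1 ≤ 1 + τ := by linarith
  have h0 : 0 < 1 + τ := by linarith
  induction s generalizing x U with
  | zero =>
    rw [zero_add]
    by_cases hk : k ≤ U.card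
    · have := hQ x U hU hk
      have h3 : 0 ≤ (1 + τ) ^ k / (1 + τ) ^ U.card * visitMgf P τ W 0 x := by
        simp only [visitMgf]; positivity
      linarith
    · have h2 := coverProb_le_one hP hP1 m x U
      have h3 : 1 ≤ (1 + τ) ^ k / (1 + τ) ^ U.card := by
        rw [one_le_div (by positivity)]
        exact pow_le_pow_right₀ h1 (by omega)
      simp only [visitMgf, mul_one]
      linarith
  | succ s ih =>
    rw [Nat.add_right_comm]
    have hsplit : Q + (1 + τ) ^ k / (1 + τ) ^ U.card * visitMgf P τ W (s + 1) x =
        ∑ y, P x y * (Q + (1 + τ) ^ k / (1 + τ) ^ U.card *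
          ((1 + if y ∈ W then τ else 0) * visitMgf P τ W s y)) := by
      simp only [mul_add, Finset.sum_add_distrib, ← Finset.sum_mul, hP1, one_mul]
      rw [visitMgf, Finset.mul_sum]
      congr 1
      exact Finset.sum_congr rfl fun y _ => by ring
    rw [hsplit]
    refine Finset.sum_le_sum fun y _ => mul_le_mul_of_nonneg_left ?_ (hP x y)
    refine (ih y ((Finset.erase_subset y U).trans hU)).trans ?_
    rw [← mul_assoc]
    have hF := visitMgf_nonneg hP hτ W s y
    -- Markov's inequality built into the induction: each newly visited point of `U ⊆ W` costs a
    -- factor `1 + τ`, which the visit weight pays for. Other visits to `W` only enlarge the bound.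
    have : (1 + τ) ^ k / (1 + τ) ^ (U.erase y).card ≤
        (1 + τ) ^ k / (1 + τ) ^ U.card * (1 + if y ∈ W then τ else 0) := by
      by_cases hy : y ∈ U
      · rw [if_pos (hU hy), ← Finset.card_erase_add_one hy, pow_succ]
        apply le_of_eq
        field_simp
      · rw [Finset.erase_eq_of_notMem hy]
        refine le_mul_of_one_le_right (by positivity) ?_
        split_ifs <;> linarith
    gcongr

/-- Bouncing along the edge `a b` misses any third vertex. -/
theorem pow_le_one_sub_coverProb (hP : ∀ x y, 0 ≤ P x y) (hP1 : ∀ x, ∑ y, P x y = 1)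
    {η : ℝ} (hη : 0 ≤ η) {a b z : V} (hab : η ≤ P a b)
    (hba : η ≤ P b a) (hza : z ≠ a) (hzb : z ≠ b) (m : ℕ) {U : Finset V} (hz : z ∈ U) :
    η ^ m ≤ 1 - coverProb P m a U := by
  induction m generalizing a b U with
  | zero =>
    have : U ≠ ∅ := Finset.ne_empty_of_mem hz
    simp [coverProb, this]
  | succ m ih =>
    have hsum : 1 - coverProb P (m + 1) a U =
        ∑ y, P a y * (1 - coverProb P m y (U.erase y)) := by
      simp only [mul_sub, Finset.sum_sub_distrib, mul_one, hP1, coverProb]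
    rw [hsum]
    refine le_trans ?_ (Finset.single_le_sum (f := fun y => P a y *
      (1 - coverProb P m y (U.erase y))) (fun y _ => mul_nonneg (hP a y)
      (sub_nonneg.mpr (coverProb_le_one hP hP1 _ _ _))) (Finset.mem_univ b))
    rw [pow_succ']
    exact mul_le_mul hab (ih hba hab hzb hza (Finset.mem_erase.mpr ⟨hzb, hz⟩)) (by positivity)
      (hP a b)

end Cover

/-! ### Transfer from the matrix recursion to the random walk -/

section RandomWalk

variable {V : Type*} [Fintype V] [DecidableEq V] {G : SimpleGraph V} [DecidableRel G.Adj]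
  {Ω : Type*} [MeasurableSpace Ω] {μ : Measure Ω} [IsProbabilityMeasure μ] {X : ℕ → Ω → V}

/-- Prolong the prefix by one step and use a union bound over the next state. Only an upper bound is
needed, so measurability of the covering events plays no role. -/
theorem IsRandomWalk.prefix_cover_le (hX : IsRandomWalk G μ X) (m s : ℕ) (w : ℕ → V)
    (U : Finset V) :
    μ.real {ω | (∀ i ≤ s, X i ω = w i) ∧ ∀ v ∈ U, ∃ t, s < t ∧ t ≤ s + m ∧ X t ω = v} ≤
      μ.real {ω | ∀ i ≤ s, X i ω = w i} * coverProb (walkMatrix G) m (w s) U := by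
  induction m generalizing s w U with
  | zero =>
    by_cases hU : U = ∅
    · simp [coverProb, hU]
    · obtain ⟨v, hv⟩ := Finset.nonempty_iff_ne_empty.mpr hU
      have : {ω | (∀ i ≤ s, X i ω = w i) ∧ ∀ v ∈ U, ∃ t, s < t ∧ t ≤ s + 0 ∧ X t ω = v} = ∅ := by
        ext ω
        simp only [Set.mem_ofPred_eq, Set.mem_empty_iff_false, iff_false]
        rintro ⟨-, h⟩
        obtain ⟨t, h1, h2, -⟩ := h v hv
        omega
      rw [this]
      simp [coverProb, hU]
  | succ m ih =>
    set w' : V → ℕ → V := fun y => Function.update w (s + 1) y with hw'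
    have hle : ∀ y, ∀ i ≤ s, w' y i = w i := fun y i hi =>
      Function.update_of_ne (by omega) _ _
    have hlast : ∀ y, w' y (s + 1) = y := fun y => Function.update_self _ _ _
    have hsub : {ω | (∀ i ≤ s, X i ω = w i) ∧
          ∀ v ∈ U, ∃ t, s < t ∧ t ≤ s + (m + 1) ∧ X t ω = v} ⊆
        ⋃ y, {ω | (∀ i ≤ s + 1, X i ω = w' y i) ∧
          ∀ v ∈ U.erase y, ∃ t, s + 1 < t ∧ t ≤ s + 1 + m ∧ X t ω = v} := by
      rintro ω ⟨h1, h2⟩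
      refine Set.mem_iUnion.mpr ⟨X (s + 1) ω, fun i hi => ?_, fun v hv => ?_⟩
      · rcases Nat.lt_or_ge s i with h | h
        · obtain rfl : i = s + 1 := by omega
          rw [hlast]
        · rw [hle _ i h, h1 i h]
      · obtain ⟨hne, hvU⟩ := Finset.mem_erase.mp hv
        obtain ⟨t, ht1, ht2, ht3⟩ := h2 v hvU
        refine ⟨t, lt_of_le_of_ne ht1 ?_, by omega, ht3⟩
        rintro rfl
        exact hne ht3.symm
    refine (measureReal_mono hsub).trans ((measureReal_iUnion_fintype_le _).trans ?_)
    rw [coverProb, Finset.mul_sum]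
    refine Finset.sum_le_sum fun y _ => (ih (s + 1) (w' y) (U.erase y)).trans (le_of_eq ?_)
    rw [hX.path_prob, hX.path_prob, Finset.prod_range_succ, hlast, hle y 0 (Nat.zero_le _),
      hle y s le_rfl, Finset.prod_congr rfl (fun i hi => by
        rw [hle y i (Finset.mem_range.mp hi).le, hle y (i + 1) (Finset.mem_range.mp hi)])]
    ring

theorem IsRandomWalk.visited_eq_univ_le (hX : IsRandomWalk G μ X) {m : ℕ} {B : ℝ}
    (hB : ∀ x, coverProb (walkMatrix G) m x Finset.univ ≤ B) :
    μ.real {ω | visited X m ω = Set.univ} ≤ B := by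
  have hsub : {ω | visited X m ω = Set.univ} ⊆
      ⋃ x, {ω | (∀ i ≤ 0, X i ω = x) ∧
        ∀ v ∈ (Finset.univ : Finset V), ∃ t, 0 < t ∧ t ≤ 0 + m ∧ X t ω = v} := by
    intro ω hω
    refine Set.mem_iUnion.mpr ⟨X 0 ω, fun i hi => by rw [Nat.le_zero.mp hi], fun v _ => ?_⟩
    have hv : v ∈ visited X m ω := by
      rw [Set.mem_ofPred_eq] at hω
      rw [hω]
      trivial
    obtain ⟨t, ht, htv⟩ := hv
    exact ⟨t, ht.1, by have := ht.2; omega, htv⟩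
  have hset : ∀ x, {ω | ∀ i ≤ 0, X i ω = x} = {ω | X 0 ω = x} := by
    intro x
    ext ω
    simp
  have htot : ∑ x, μ.real {ω | X 0 ω = x} = 1 := by
    rw [← measureReal_iUnion_fintype (fun x y hxy => ?_) (fun x => hX.measurableSet_eq 0 x)]
    · have : (⋃ x, {ω | X 0 ω = x}) = Set.univ :=
        Set.eq_univ_of_forall fun ω => Set.mem_iUnion.mpr ⟨X 0 ω, rfl⟩
      rw [this, probReal_univ]
    · exact Set.disjoint_left.mpr fun ω h1 h2 => hxy (h1.symm.trans h2)
  refine (measureReal_mono hsub).trans ((measureReal_iUnion_fintype_le _).trans ?_)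
  calc _ ≤ ∑ x, μ.real {ω | X 0 ω = x} * B := Finset.sum_le_sum fun x _ => by
        refine (hX.prefix_cover_le m 0 (fun _ => x) Finset.univ).trans ?_
        rw [hset]
        exact mul_le_mul_of_nonneg_left (hB x) measureReal_nonneg
    _ = B := by rw [← Finset.sum_mul, htot, one_mul]

end RandomWalk

/-! ### Number of visits to a fixed set -/

/-- Here `a` and `B` stand for the mean and variance of a function, and `p` for `π(W)`. Error terms
in `a ^ 2` carry a factor `p`, with total coefficient below `10 τ`. Those in `B` lack it, but their
coefficient is below `8 τ`, and the gap leaves `(1 - ρ) * B` to absorb them. -/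
theorem gap_perturbation_le {a p e B w ρ τ : ℝ} (hp0 : 0 ≤ p) (hp1 : p ≤ 1) (hB0 : 0 ≤ B)
    (he : e ^ 2 ≤ p * B) (hw0 : 0 ≤ w) (hw : w ≤ 2 * a ^ 2 * p + 2 * B) (hρ0 : 0 ≤ ρ)
    (hτ0 : 0 ≤ τ) (hτ : τ ≤ (1 - ρ) / 24) :
    ρ * (a ^ 2 + B + (2 * τ + τ ^ 2) * w) + (1 - ρ) * (a + τ * (a * p + e)) ^ 2 ≤
      (1 + 10 * τ * p) * (a ^ 2 + B) := by
  have hτ1 : τ ≤ 1 / 24 := by linarith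
  have hρ1 : ρ ≤ 1 := by linarith
  have hρ1' : 0 ≤ 1 - ρ := by linarith
  have hap : 0 ≤ a ^ 2 * p := by positivity
  have hae : 2 * (a * e) ≤ a ^ 2 * p + B := by
    refine (abs_le_of_sq_le_sq' ?_ (by positivity)).2
    have h1 : a ^ 2 * e ^ 2 ≤ a ^ 2 * (p * B) := mul_le_mul_of_nonneg_left he (sq_nonneg a)
    linarith [sq_nonneg (a ^ 2 * p - B)]
  have hape : (a * p + e) ^ 2 ≤ 2 * (a ^ 2 * p) + 2 * B := by
    have h1 : a ^ 2 * p * p ≤ a ^ 2 * p := mul_le_of_le_one_right hap hp1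
    have h2 : p * B ≤ B := mul_le_of_le_one_left hB0 hp1
    linarith [sq_nonneg (a * p - e)]
  have h1 : (2 * τ + τ ^ 2) * w ≤ 3 * τ * (2 * a ^ 2 * p + 2 * B) := by
    have : 2 * τ + τ ^ 2 ≤ 3 * τ := by nlinarith
    exact mul_le_mul this hw hw0 (by positivity)
  have h2 : (a + τ * (a * p + e)) ^ 2 ≤ a ^ 2 + τ * (3 * (a ^ 2 * p) + B) +
      τ * (1 / 24 * (2 * (a ^ 2 * p) + 2 * B)) := by
    have h3 : τ ^ 2 * (a * p + e) ^ 2 ≤ τ * (1 / 24 * (2 * (a ^ 2 * p) + 2 * B)) := by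
      rw [sq τ, mul_assoc]
      refine mul_le_mul_of_nonneg_left ?_ hτ0
      exact mul_le_mul hτ1 hape (sq_nonneg _) (by norm_num)
    have h4 : τ * (2 * (a * e)) ≤ τ * (a ^ 2 * p + B) := mul_le_mul_of_nonneg_left hae hτ0
    linarith
  have h5 : ρ * ((2 * τ + τ ^ 2) * w) ≤ 3 * τ * (2 * a ^ 2 * p + 2 * B) :=
    (mul_le_of_le_one_left (by positivity) hρ1).trans h1
  have h6 : (1 - ρ) * (a + τ * (a * p + e)) ^ 2 ≤ (1 - ρ) * a ^ 2 +
      (τ * (3 * (a ^ 2 * p) + B) + τ * (1 / 24 * (2 * (a ^ 2 * p) + 2 * B))) := by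
    refine (mul_le_mul_of_nonneg_left h2 hρ1').trans ?_
    have : (1 - ρ) * (τ * (3 * (a ^ 2 * p) + B) + τ * (1 / 24 * (2 * (a ^ 2 * p) + 2 * B))) ≤
        τ * (3 * (a ^ 2 * p) + B) + τ * (1 / 24 * (2 * (a ^ 2 * p) + 2 * B)) :=
      mul_le_of_le_one_left (by positivity) (by linarith)
    linarith
  have h7 : τ * B ≤ (1 - ρ) / 24 * B := mul_le_mul_of_nonneg_right hτ hB0
  have h8 : 0 ≤ τ * p * B := by positivity
  have h9 : 0 ≤ (1 - ρ) * B := by positivity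
  have h10 : 0 ≤ τ * (a ^ 2 * p) := by positivity
  linarith

section Visits

variable {V : Type*} [Fintype V] [DecidableEq V]

/-- Split `g` into its mean and a centred part. The mean sees `W` only through its mass, and the
growth of the centred part is offset by the contraction. -/
theorem sum_sq_mulVec_visit_le {P : Matrix V V ℝ} {π : V → ℝ} (hπ : ∀ v, 0 ≤ π v)
    (hπ1 : ∑ v, π v = 1) {ρ : ℝ} (hρ0 : 0 ≤ ρ)
    (hgap : ∀ f : V → ℝ, ∑ v, π v * P.mulVec f v ^ 2 ≤
      ρ * ∑ v, π v * f v ^ 2 + (1 - ρ) * (∑ v, π v * f v) ^ 2)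
    {τ : ℝ} (hτ0 : 0 ≤ τ) (hτ : τ ≤ (1 - ρ) / 24) (W : Finset V) (g : V → ℝ) :
    ∑ v, π v * P.mulVec (fun v => (1 + if v ∈ W then τ else 0) * g v) v ^ 2 ≤
      (1 + 10 * τ * ∑ v ∈ W, π v) * ∑ v, π v * g v ^ 2 := by
  set p := ∑ v ∈ W, π v with hp
  set a := ∑ v, π v * g v with ha
  set B := ∑ v, π v * (g v - a) ^ 2 with hB
  set e := ∑ v ∈ W, π v * (g v - a) with he
  have hp0 : 0 ≤ p := Finset.sum_nonneg fun v _ => hπ v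
  have hp1 : p ≤ 1 := hπ1 ▸ Finset.sum_le_univ_sum_of_nonneg hπ
  have hB0 : 0 ≤ B := Finset.sum_nonneg fun v _ => mul_nonneg (hπ v) (sq_nonneg _)
  have hBW : ∑ v ∈ W, π v * (g v - a) ^ 2 ≤ B :=
    Finset.sum_le_univ_sum_of_nonneg fun v => mul_nonneg (hπ v) (sq_nonneg _)
  have hG : ∑ v, π v * g v ^ 2 = a ^ 2 + B := by
    have : B = ∑ v, π v * g v ^ 2 - 2 * a * (∑ v, π v * g v) + a ^ 2 * ∑ v, π v := by
      rw [hB, Finset.mul_sum _ _ (2 * a), Finset.mul_sum _ _ (a ^ 2), ← Finset.sum_sub_distrib,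
        ← Finset.sum_add_distrib]
      exact Finset.sum_congr rfl fun v _ => by ring
    rw [this, hπ1, ← ha]
    ring
  have he2 : e ^ 2 ≤ p * B := by
    have h1 : e ^ 2 ≤ (∑ v ∈ W, π v) * ∑ v ∈ W, π v * (g v - a) ^ 2 := by
      refine Finset.sum_sq_le_sum_mul_sum_of_sq_le_mul W (fun v _ => hπ v)
        (fun v _ => mul_nonneg (hπ v) (sq_nonneg _)) fun v _ => le_of_eq (by ring)
    exact h1.trans (mul_le_mul_of_nonneg_left hBW hp0)
  have hu : ∑ v ∈ W, π v * g v = a * p + e := by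
    rw [he, hp, Finset.mul_sum, ← Finset.sum_add_distrib]
    exact Finset.sum_congr rfl fun v _ => by ring
  have hv : ∑ v ∈ W, π v * g v ^ 2 ≤ 2 * a ^ 2 * p + 2 * B := by
    calc _ ≤ ∑ v ∈ W, (2 * a ^ 2 * π v + 2 * (π v * (g v - a) ^ 2)) :=
          Finset.sum_le_sum fun v _ => by
            nlinarith [mul_nonneg (hπ v) (sq_nonneg (g v - a - a))]
      _ = 2 * a ^ 2 * p + 2 * ∑ v ∈ W, π v * (g v - a) ^ 2 := by
          rw [Finset.sum_add_distrib, ← Finset.mul_sum, ← Finset.mul_sum]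
      _ ≤ _ := by linarith
  have hind : ∀ F : V → ℝ, ∑ v ∈ W, F v = ∑ v, if v ∈ W then F v else 0 := fun F => by
    simp [Finset.sum_ite_mem]
  have hmean : ∑ v, π v * ((1 + if v ∈ W then τ else 0) * g v) = a + τ * (a * p + e) := by
    rw [← hu, ha, hind, Finset.mul_sum, ← Finset.sum_add_distrib]
    refine Finset.sum_congr rfl fun v _ => ?_
    split_ifs <;> ring
  have hsq : ∑ v, π v * ((1 + if v ∈ W then τ else 0) * g v) ^ 2 =
      (a ^ 2 + B) + (2 * τ + τ ^ 2) * ∑ v ∈ W, π v * g v ^ 2 := by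
    rw [← hG, hind, Finset.mul_sum, ← Finset.sum_add_distrib]
    refine Finset.sum_congr rfl fun v _ => ?_
    split_ifs <;> ring
  refine (hgap _).trans ?_
  rw [hmean, hsq, hG]
  exact gap_perturbation_le hp0 hp1 hB0 he2
    (Finset.sum_nonneg fun v _ => mul_nonneg (hπ v) (sq_nonneg _)) hv hρ0 hτ0 hτ

theorem sum_visitMgf_sq_le {P : Matrix V V ℝ} {π : V → ℝ} (hπ : ∀ v, 0 ≤ π v)
    (hπ1 : ∑ v, π v = 1) {ρ : ℝ} (hρ0 : 0 ≤ ρ)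
    (hgap : ∀ f : V → ℝ, ∑ v, π v * P.mulVec f v ^ 2 ≤
      ρ * ∑ v, π v * f v ^ 2 + (1 - ρ) * (∑ v, π v * f v) ^ 2)
    {τ : ℝ} (hτ0 : 0 ≤ τ) (hτ : τ ≤ (1 - ρ) / 24) (W : Finset V) (m : ℕ) :
    ∑ v, π v * visitMgf P τ W m v ^ 2 ≤ (1 + 10 * τ * ∑ v ∈ W, π v) ^ m := by
  induction m with
  | zero => simp [visitMgf, hπ1]
  | succ m ih =>
    have h0 : 0 ≤ 1 + 10 * τ * ∑ v ∈ W, π v := by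
      have := Finset.sum_nonneg fun v (_ : v ∈ W) => hπ v
      positivity
    refine (sum_sq_mulVec_visit_le hπ hπ1 hρ0 hgap hτ0 hτ W (visitMgf P τ W m)).trans ?_
    rw [pow_succ']
    exact mul_le_mul_of_nonneg_left ih h0

/-- Bound on the exponential moment of the number of visits, from any starting point. -/
theorem visitMgf_le_mul_exp {P : Matrix V V ℝ} {π : V → ℝ}
    (hπ1 : ∑ v, π v = 1) {ρ : ℝ} (hρ0 : 0 ≤ ρ)
    (hgap : ∀ f : V → ℝ, ∑ v, π v * P.mulVec f v ^ 2 ≤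
      ρ * ∑ v, π v * f v ^ 2 + (1 - ρ) * (∑ v, π v * f v) ^ 2)
    {τ : ℝ} (hτ0 : 0 ≤ τ) (hτ : τ ≤ (1 - ρ) / 24) {N : ℝ} (hN : 0 < N)
    (hπN : ∀ v, 1 ≤ N ^ 2 * π v) (W : Finset V) (m : ℕ) (x : V) :
    visitMgf P τ W m x ≤ N * Real.exp (5 * τ * (∑ v ∈ W, π v) * m) := by
  have hπ : ∀ v, 0 ≤ π v := fun v =>
    (pos_of_mul_pos_right (zero_lt_one.trans_le (hπN v)) (sq_nonneg N)).le
  set p := ∑ v ∈ W, π v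
  have hp0 : 0 ≤ p := Finset.sum_nonneg fun v _ => hπ v
  refine abs_le_of_sq_le_sq' ?_ (by positivity) |>.2
  -- Passing from `L²(π)` to a single point costs `1 / π x ≤ N ^ 2`. The square root leaves `N` and
  -- halves the constant `10`.
  calc visitMgf P τ W m x ^ 2 ≤ N ^ 2 * (π x * visitMgf P τ W m x ^ 2) := by
        rw [← mul_assoc]
        exact le_mul_of_one_le_left (sq_nonneg _) (hπN x)
    _ ≤ N ^ 2 * ∑ v, π v * visitMgf P τ W m v ^ 2 := by
        gcongr
        exact Finset.single_le_sum (f := fun v => π v * visitMgf P τ W m v ^ 2)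
          (fun v _ => mul_nonneg (hπ v) (sq_nonneg _)) (Finset.mem_univ x)
    _ ≤ N ^ 2 * (1 + 10 * τ * p) ^ m := by
        gcongr
        exact sum_visitMgf_sq_le hπ hπ1 hρ0 hgap hτ0 hτ W m
    _ ≤ N ^ 2 * Real.exp (10 * τ * p) ^ m := by
        gcongr
        linarith [Real.add_one_le_exp (10 * τ * p)]
    _ = (N * Real.exp (5 * τ * p * m)) ^ 2 := by
        rw [mul_pow, ← Real.exp_nat_mul, ← Real.exp_nat_mul]
        congr 2
        push_cast
        ring

end Visits

/-! ### Iterating over blocks of linear length -/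

section Blocks

variable {V : Type*} [Fintype V]

/-- At least half of the points have weight at most twice the average. -/
theorem card_le_two_mul_card_filter {π : V → ℝ} (hπ : ∀ v, 0 ≤ π v) (hπ1 : ∑ v, π v = 1) :
    (Fintype.card V : ℝ) ≤
      2 * (Finset.univ.filter fun v => π v * Fintype.card V ≤ 2).card := by
  set S := Finset.univ.filter fun v => π v * Fintype.card V ≤ 2
  have hcard : (S.card : ℝ) + (Finset.univ.filter fun v => ¬ π v * Fintype.card V ≤ 2).card =
      Fintype.card V := by
    exact_mod_cast Finset.card_filter_add_card_filter_not (s := Finset.univ)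
      (fun v => π v * Fintype.card V ≤ 2)
  have h1 : 2 * ((Finset.univ.filter fun v => ¬ π v * Fintype.card V ≤ 2).card : ℝ) ≤
      Fintype.card V := by
    calc _ = ∑ v ∈ Finset.univ.filter (fun v => ¬ π v * Fintype.card V ≤ 2), (2 : ℝ) := by
          rw [Finset.sum_const, nsmul_eq_mul, mul_comm]
      _ ≤ ∑ v ∈ Finset.univ.filter (fun v => ¬ π v * Fintype.card V ≤ 2),
            π v * Fintype.card V :=
          Finset.sum_le_sum fun v hv => (not_le.mp (Finset.mem_filter.mp hv).2).le
      _ ≤ ∑ v, π v * Fintype.card V :=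
          Finset.sum_le_univ_sum_of_nonneg fun v => mul_nonneg (hπ v) (Nat.cast_nonneg _)
      _ = _ := by rw [← Finset.sum_mul, hπ1, one_mul]
  linarith

variable [DecidableEq V]

/-- If the number of visits to every subset of `S` during a block of `L` steps has a small
exponential moment, then covering `S` in `j` blocks is unlikely. -/
theorem coverProb_blocks_le {P : Matrix V V ℝ} (hP : ∀ x y, 0 ≤ P x y)
    (hP1 : ∀ x, ∑ y, P x y = 1) {τ N D : ℝ} (hτ0 : 0 ≤ τ) (hτ1 : τ ≤ 1) (hN : 0 ≤ N)
    (hD : 1 ≤ D) {S : Finset V} {L : ℕ}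
    (hF : ∀ W ⊆ S, ∀ x, visitMgf P τ W L x ≤ N * Real.exp (τ * W.card / 8))
    (j : ℕ) (x : V) {W : Finset V} (hW : W ⊆ S) (hWD : 3 ^ j * D ≤ W.card) :
    coverProb P (j * L) x W ≤ j * (N * Real.exp (-(τ * D / 8))) := by
  induction j generalizing x W with
  | zero =>
    have hne : W ≠ ∅ := by
      rintro rfl
      simp at hWD
      linarith
    simp [coverProb, hne]
  | succ j ih =>
    set w := W.card
    set Q := j * (N * Real.exp (-(τ * D / 8))) with hQ
    have h3 : (1 : ℝ) ≤ 3 ^ j := one_le_pow₀ (by norm_num)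
    have hw3 : (3 : ℝ) ≤ w := by
      rw [pow_succ] at hWD
      nlinarith
    have hw3' : 3 ≤ w := by exact_mod_cast hw3
    have hDw : D ≤ w := by
      rw [pow_succ] at hWD
      nlinarith
    -- The threshold is half of `W`, rounded down. Since `w ≥ 3`, this is still at least a third,
    -- hence the base `3` in `hWD`.
    have hk : ∀ y, ∀ U ⊆ W, w / 2 ≤ U.card → coverProb P (j * L) y U ≤ Q := by
      intro y U hU hUk
      refine ih y (hU.trans hW) ?_
      have h1 : (w : ℝ) ≤ 3 * U.card := by exact_mod_cast (by omega : w ≤ 3 * U.card)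
      rw [pow_succ] at hWD
      linarith
    have hadd := coverProb_add_le hP hP1 hτ0 (by positivity : 0 ≤ Q) hk L x (Finset.Subset.refl W)
    rw [show (j + 1) * L = L + j * L by ring]
    refine hadd.trans ?_
    have hratio : (1 + τ) ^ (w / 2) / (1 + τ) ^ w ≤ Real.exp (-(τ * w / 4)) := by
      have hpos : 0 < 1 + τ := by linarith
      have hexp : Real.exp (τ / 2) ≤ 1 + τ := by
        have := Real.exp_bound_div_one_sub_of_interval (x := τ / 2) (by linarith) (by linarith)
        refine this.trans ?_
        rw [div_le_iff₀ (by linarith)]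
        nlinarith
      rw [div_le_iff₀ (by positivity), Real.exp_neg, inv_mul_eq_div, le_div_iff₀ (Real.exp_pos _)]
      have h2 : (1 + τ) ^ w = (1 + τ) ^ (w / 2) * (1 + τ) ^ (w - w / 2) := by
        rw [← pow_add]
        congr 1
        omega
      rw [h2]
      refine mul_le_mul_of_nonneg_left ?_ (by positivity)
      calc Real.exp (τ * w / 4) ≤ Real.exp ((w - w / 2 : ℕ) * (τ / 2)) := by
            apply Real.exp_le_exp.mpr
            have : (w : ℝ) ≤ 2 * (w - w / 2 : ℕ) := by
              exact_mod_cast (by omega : w ≤ 2 * (w - w / 2))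
            nlinarith
        _ = Real.exp (τ / 2) ^ (w - w / 2) := Real.exp_nat_mul _ _
        _ ≤ _ := pow_le_pow_left₀ (Real.exp_pos _).le hexp _
    have hlast : (1 + τ) ^ (w / 2) / (1 + τ) ^ w * visitMgf P τ W L x ≤
        N * Real.exp (-(τ * D / 8)) := by
      calc _ ≤ Real.exp (-(τ * w / 4)) * (N * Real.exp (τ * w / 8)) :=
            mul_le_mul hratio (hF W hW x) (visitMgf_nonneg hP hτ0 W L x) (Real.exp_pos _).le
        _ = N * Real.exp (-(τ * w / 8)) := by
            rw [mul_left_comm, ← Real.exp_add]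
            ring_nf
        _ ≤ _ := by
            gcongr
    calc _ ≤ Q + N * Real.exp (-(τ * D / 8)) := by gcongr
      _ = _ := by rw [hQ]; push_cast; ring

end Blocks

/-! ### Visit bounds for expanders, and graphs with few vertices -/

section Expander

variable {V : Type*} [Fintype V] [DecidableEq V] {G : SimpleGraph V} [DecidableRel G.Adj]

/-- In a block of `n / 160` steps, an expander walk makes few visits to a set of vertices of low
degree. -/
theorem IsExpander.visitMgf_le {ε : ℝ} (h : IsExpander G ε) (hε : 0 < ε)
    (h2 : 2 ≤ Fintype.card V) (hd : ∀ v, 0 < G.degree v) {τ : ℝ} (hτ0 : 0 ≤ τ)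
    (hτ : τ ≤ (1 - (1 - ε) ^ 2) / 24) :
    ∃ S : Finset V, (Fintype.card V : ℝ) ≤ 2 * S.card ∧ ∀ W ⊆ S, ∀ x,
      visitMgf (walkMatrix G) τ W (Fintype.card V / 160) x ≤
        Fintype.card V * Real.exp (τ * W.card / 8) := by
  set n := Fintype.card V
  set M : ℝ := ∑ v, (G.degree v : ℝ) with hM
  have hn : (0 : ℝ) < n := by exact_mod_cast (by omega : 0 < n)
  have hMpos : 0 < M := by
    have : Nonempty V := Fintype.card_pos_iff.mp (by omega)
    exact Finset.sum_pos (fun v _ => by exact_mod_cast hd v) Finset.univ_nonempty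
  have hMle : M ≤ (n : ℝ) ^ 2 := by
    calc M ≤ ∑ _v : V, (n : ℝ) := Finset.sum_le_sum fun v _ => by
          exact_mod_cast (G.degree_lt_card_verts v).le
      _ = _ := by rw [Finset.sum_const, Finset.card_univ, nsmul_eq_mul, sq]
  set π : V → ℝ := fun v => G.degree v / M with hπdef
  have hπ : ∀ v, 0 ≤ π v := fun v => by positivity
  have hπ1 : ∑ v, π v = 1 := by rw [← Finset.sum_div, div_self hMpos.ne']
  have hgap : ∀ f : V → ℝ, ∑ v, π v * (walkMatrix G).mulVec f v ^ 2 ≤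
      (1 - ε) ^ 2 * ∑ v, π v * f v ^ 2 + (1 - (1 - ε) ^ 2) * (∑ v, π v * f v) ^ 2 := by
    intro f
    have key := div_le_div_of_nonneg_right (h.sum_mulVec_sq_le hε h2 hd f) hMpos.le
    have e : ∀ g : V → ℝ, ∑ v, π v * g v = (∑ v, (G.degree v : ℝ) * g v) / M := fun g => by
      rw [Finset.sum_div]
      exact Finset.sum_congr rfl fun v _ => by simp only [hπdef]; ring
    rw [e, e fun v => f v ^ 2, e f]
    refine key.trans (le_of_eq ?_)
    rw [← hM]
    field_simp
  have hπN : ∀ v, 1 ≤ (n : ℝ) ^ 2 * π v := by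
    intro v
    have : (1 : ℝ) ≤ G.degree v := by exact_mod_cast hd v
    rw [hπdef, ← mul_div_assoc, one_le_div hMpos]
    nlinarith
  refine ⟨_, card_le_two_mul_card_filter hπ hπ1, fun W hW x => ?_⟩
  refine (visitMgf_le_mul_exp hπ1 (sq_nonneg _) hgap hτ0 hτ hn hπN W _ x).trans ?_
  gcongr
  have hp : (∑ v ∈ W, π v) * n ≤ 2 * W.card := by
    rw [Finset.sum_mul, mul_comm, ← nsmul_eq_mul]
    exact Finset.sum_le_card_nsmul _ _ _ fun v hv => (Finset.mem_filter.mp (hW hv)).2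
  have hL : ((n / 160 : ℕ) : ℝ) ≤ n / 160 := by exact_mod_cast Nat.cast_div_le
  have hp0 : 0 ≤ ∑ v ∈ W, π v := Finset.sum_nonneg fun v _ => hπ v
  calc 5 * τ * (∑ v ∈ W, π v) * (n / 160 : ℕ) ≤ 5 * τ * (∑ v ∈ W, π v) * (n / 160) := by gcongr
    _ = τ / 32 * ((∑ v ∈ W, π v) * n) := by ring
    _ ≤ τ / 32 * (2 * W.card) := by gcongr
    _ ≤ τ * W.card / 8 := by
        have : 0 ≤ τ * W.card := by positivity
        linarith

/-- A single edge has eigenvalue `-1`, so it is no expander. The exclusion matters: there the walk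
surely covers both vertices in two steps. -/
theorem IsExpander.three_le_card {ε : ℝ} (h : IsExpander G ε) (hε : 0 < ε)
    (h2 : 2 ≤ Fintype.card V) (hd : ∀ v, 0 < G.degree v) : 3 ≤ Fintype.card V := by
  by_contra hlt
  have hc : Fintype.card V = 2 := by omega
  have hdeg : ∀ v, G.degree v = 1 := fun v => by
    have := G.degree_lt_card_verts v
    have := hd v
    omega
  obtain ⟨a, b, hab, huniv⟩ := Finset.card_eq_two.mp (Finset.card_univ.trans hc)
  have hadj : G.Adj a b := by
    obtain ⟨c, hac⟩ := (G.degree_pos_iff_exists_adj a).mp (hd a)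
    have hcm : c ∈ ({a, b} : Finset V) := huniv ▸ Finset.mem_univ c
    rcases Finset.mem_insert.mp hcm with rfl | hcb
    · exact absurd hac (G.irrefl)
    · rwa [← Finset.mem_singleton.mp hcb]
  have key := h.sum_mulVec_sq_le hε h2 hd fun v => if v = a then 1 else -1
  have hε1 := h.lt_one
  simp only [huniv, Finset.sum_pair hab, hdeg, Matrix.mulVec, dotProduct, walkMatrix,
    Matrix.of_apply, hadj, hadj.symm, hab.symm, G.irrefl, if_true, if_false] at key
  norm_num at key
  rw [abs_of_pos (by linarith)] at key
  linarith

theorem IsExpander.coverProb_le_one_sub {ε : ℝ} (h : IsExpander G ε) (hε : 0 < ε)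
    (h2 : 2 ≤ Fintype.card V) (hd : ∀ v, 0 < G.degree v) (m : ℕ) (x : V) :
    coverProb (walkMatrix G) m x Finset.univ ≤ 1 - (1 / (Fintype.card V : ℝ)) ^ m := by
  have h3 := h.three_le_card hε h2 hd
  obtain ⟨b, hxb⟩ := (G.degree_pos_iff_exists_adj x).mp (hd x)
  obtain ⟨z, hz⟩ : ∃ z, z ∉ ({x, b} : Finset V) := by
    by_contra! hall
    have := (Finset.card_le_card (fun v _ => hall v : (Finset.univ : Finset V) ⊆ _)).trans
      Finset.card_le_two
    rw [Finset.card_univ] at this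
    omega
  simp only [Finset.mem_insert, Finset.mem_singleton, not_or] at hz
  have hP : ∀ u v, G.Adj u v → 1 / (Fintype.card V : ℝ) ≤ walkMatrix G u v := by
    intro u v huv
    simp only [walkMatrix, Matrix.of_apply, if_pos huv]
    have h1 : (0 : ℝ) < G.degree u := by exact_mod_cast hd u
    have h2 : (G.degree u : ℝ) ≤ Fintype.card V := by exact_mod_cast (G.degree_lt_card_verts u).le
    gcongr
  have := pow_le_one_sub_coverProb (walkMatrix_nonneg G) (walkMatrix_sum_row G hd)
    (by positivity) (hP x b hxb) (hP b x hxb.symm) hz.1 hz.2 m (Finset.mem_univ z)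
  linarith

end Expander

/-! ### Linear cover time -/

theorem mainTheorem7 (ε C : ℝ) (hε : 0 < ε) :
    ∃ c : ℝ, 0 < c ∧
      ∀ (V : Type*) [Fintype V] [DecidableEq V] (G : SimpleGraph V) [DecidableRel G.Adj],
        2 ≤ Fintype.card V → G.Connected → IsExpander G ε →
        ∀ (Ω : Type*) [MeasurableSpace Ω] (μ : Measure Ω) [IsProbabilityMeasure μ]
          (X : ℕ → Ω → V), IsRandomWalk G μ X →
          μ.real {ω | visited X ⌊C * (Fintype.card V : ℝ)⌋₊ ω = Set.univ} ≤
            Real.exp (-(c * (Fintype.card V : ℝ))) := by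
  by_cases hε1 : ε < 1
  swap
  · exact ⟨1, one_pos, fun V _ _ G _ _ _ h => absurd h.lt_one hε1⟩
  set τ := (1 - (1 - ε) ^ 2) / 24 with hτ
  have hτ0 : 0 < τ := by nlinarith
  have hτ1 : τ ≤ 1 := by nlinarith [sq_nonneg (1 - ε)]
  -- Once `n ≥ 160`, the rounded block length `n / 160` is at least `n / 320`, so `K` blocks
  -- suffice. The choice of `δ` gives `3 ^ K * (δ * n) = n / 2 ≤ |S|`, and `a` is half of the
  -- exponential rate `τ * δ / 8`.
  set K := ⌈320 * C⌉₊
  set δ : ℝ := 1 / (2 * 3 ^ K) with hδ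
  have hδ0 : 0 < δ := by positivity
  set a := τ * δ / 16 with ha
  have ha0 : 0 < a := by positivity
  -- The summands ensure, in turn, the block length bound, `1 ≤ δ * n`, and `K * n ≤ (a * n) ^ 2 / 2
  -- ≤ exp (a * n)`, which spends the other half of the rate.
  set n₀ := 160 + ⌈1 / δ⌉₊ + ⌈2 * K / a ^ 2⌉₊ with hn₀
  have hn₀1 : (1 : ℝ) ≤ n₀ := by exact_mod_cast (by omega : 1 ≤ n₀)
  set η := (1 / (n₀ : ℝ)) ^ ⌊|C| * n₀⌋₊ with hη
  have hη0 : 0 < η := by positivity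
  refine ⟨min a (η / n₀), by positivity, ?_⟩
  intro V _ _ G _ h2 hconn hexp Ω _ μ _ X hX
  set n := Fintype.card V
  have hd : ∀ v, 0 < G.degree v := fun v => by
    have : Nontrivial V := Fintype.one_lt_card_iff_nontrivial.mp h2
    exact hconn.preconnected.degree_pos_of_nontrivial v
  have hn0 : (0 : ℝ) < n := by exact_mod_cast (by omega : 0 < n)
  refine hX.visited_eq_univ_le fun x => ?_
  rcases lt_or_ge n n₀ with hlt | hge
  · -- few vertices: the walk may bounce along one edge
    have hnn : (n : ℝ) ≤ n₀ := by exact_mod_cast hlt.le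
    have hpow : η ≤ (1 / (n : ℝ)) ^ ⌊C * n⌋₊ := by
      calc η ≤ (1 / (n₀ : ℝ)) ^ ⌊C * n⌋₊ := by
            refine pow_le_pow_of_le_one (by positivity) ?_ (Nat.floor_le_floor ?_)
            · rw [div_le_one (by linarith)]
              exact hn₀1
            · exact mul_le_mul (le_abs_self C) hnn hn0.le (abs_nonneg C)
        _ ≤ _ := by gcongr
    refine (hexp.coverProb_le_one_sub hε h2 hd _ x).trans ?_
    calc 1 - (1 / (n : ℝ)) ^ ⌊C * n⌋₊ ≤ -η + 1 := by linarith
      _ ≤ Real.exp (-η) := Real.add_one_le_exp _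
      _ ≤ _ := by
        apply Real.exp_le_exp.mpr
        have h1 : min a (η / n₀) * n ≤ η / n₀ * n₀ :=
          mul_le_mul (min_le_right _ _) hnn hn0.le (by positivity)
        rw [div_mul_cancel₀ _ (by linarith)] at h1
        linarith
  · obtain ⟨S, hS, hF⟩ := hexp.visitMgf_le hε h2 hd hτ0.le hτ.le
    have hD : 1 ≤ δ * n := by
      have h1 : 1 / δ ≤ n := (Nat.le_ceil _).trans (by exact_mod_cast (by omega : ⌈1 / δ⌉₊ ≤ n))
      rwa [div_le_iff₀ hδ0, mul_comm] at h1
    have hSD : 3 ^ K * (δ * n) ≤ S.card := by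
      have : (3 : ℝ) ^ K * (δ * n) = n / 2 := by
        rw [hδ]
        field_simp
      linarith
    have hm : ⌊C * n⌋₊ ≤ K * (n / 160) := by
      apply Nat.floor_le_of_le
      have h1 : 320 * C ≤ K := Nat.le_ceil _
      have h3 : (n : ℝ) ≤ 320 * (n / 160 : ℕ) := by
        exact_mod_cast (by omega : n ≤ 320 * (n / 160))
      push_cast
      nlinarith [Nat.cast_nonneg (α := ℝ) K]
    have hP := walkMatrix_nonneg G
    have hP1 := walkMatrix_sum_row G hd
    have hKn : K * n ≤ Real.exp (a * n) := by
      have h1 : 2 * K / a ^ 2 ≤ n :=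
        (Nat.le_ceil _).trans (by exact_mod_cast (by omega : ⌈2 * K / a ^ 2⌉₊ ≤ n))
      rw [div_le_iff₀ (by positivity)] at h1
      have h3 := Real.quadratic_le_exp_of_nonneg (by positivity : 0 ≤ a * n)
      have h4 : 2 * K * n ≤ (a * n) ^ 2 := by
        calc 2 * K * n ≤ n * a ^ 2 * n := by gcongr
          _ = _ := by ring
      have h5 : 0 ≤ a * n := by positivity
      linarith
    calc coverProb (walkMatrix G) ⌊C * n⌋₊ x Finset.univ
        ≤ coverProb (walkMatrix G) (K * (n / 160)) x Finset.univ :=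
          coverProb_mono hP hP1 hm x _
      _ ≤ coverProb (walkMatrix G) (K * (n / 160)) x S :=
          coverProb_anti hP (Finset.subset_univ S) _ x
      _ ≤ K * (n * Real.exp (-(τ * (δ * n) / 8))) :=
          coverProb_blocks_le hP hP1 hτ0.le hτ1 hn0.le hD hF K x (Finset.Subset.refl S) hSD
      _ = K * n * Real.exp (-(2 * (a * n))) := by
          rw [ha, ← mul_assoc]
          congr 2
          ring
      _ ≤ Real.exp (a * n) * Real.exp (-(2 * (a * n))) := by gcongr
      _ = Real.exp (-(a * n)) := by
          rw [← Real.exp_add]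
          congr 1
          ring
      _ ≤ _ := by
          apply Real.exp_le_exp.mpr
          have : min a (η / n₀) * n ≤ a * n := by gcongr; exact min_le_left _ _
          linarith
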